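/- Let $\mathscr{A}$ be a unital $C^*$-algebra, let $\mathscr{G}$ be the group of invertible elements of $\mathscr{A}$, a real Banach-Lie group which is open in $\mathscr{A}$ and has Lie algebra $\mathscr{A}$, and let $\alpha$ be the left action of $\mathscr{G}$ on the space $\mathscr{A}^*_{sa}$ of self-adjoint continuous linear functionals given by $\alpha(g,\xi)(b)=\xi(g^\dagger b\,g)$. Let $\tau$ be a faithful finite trace on $\mathscr{A}$, that is, a positive linear functional with $\tau(ab)=\tau(ba)$ for all $a,b\in\mathscr{A}$ and $\tau(a)>0$ for every nonzero positive $a$. Let $\mathscr{G}_\tau=\{g\in\mathscr{G}:\alpha(g,\tau)=\tau\}$ be its isotropy group and $\mathcal{O}^\tau_+=\{\alpha(g,\tau):g\in\mathscr{G}\}$ its orbit. Then: 1. The Lie algebra $\mathfrak{g}_\tau=\{a\in\mathscr{A}:\exp(ta)\in\mathscr{G}_\tau\ \forall t\in\mathbb{R}\}$ of $\mathscr{G}_\tau$ is exactly the space of skew-adjoint elements of $\mathscr{A}$. It is a closed real subspace of $\mathscr{A}$, and it is topologically complemented by the closed real subspace of self-adjoint elements. 2. The orbit $\mathcal{O}^\tau_+$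 is a smooth homogeneous Banach manifold of $\mathscr{G}$: the group $\mathscr{G}_\tau$ is a Banach-Lie subgroup of $\mathscr{G}$ (a subgroup that is also a split Banach submanifold), the coset space $\mathscr{G}/\mathscr{G}_\tau$ with the quotient topology is a smooth real Hausdorff Banach manifold on which $\mathscr{G}$ acts smoothly by left translation and for which the projection from $\mathscr{G}$ is a smooth submersion, and $\mathcal{O}^\tau_+$ carries a smooth real Banach manifold structure for which the bijection $[g]\mapsto\alpha(g,\tau)$ from $\mathscr{G}/\mathscr{G}_\tau$ is a diffeomorphism. For this structure $g\mapsto\alpha(g,\tau)$ is a smooth surjective submersion $\mathscr{G}\to\mathcal{O}^\tau_+$ whose tangent map at the identity has kernel $\mathfrak{g}_\tau$, and $\mathscr{G}$ acts smoothly on $\mathcal{O}^\tau_+$. 3. The positive invertible elements of $\mathscr{A}$ are exactly the elements $gg^\dagger$ with $g\in\mathscr{G}$, and $\alpha(g,\tau)\mapsto gg^\dagger$ is a well-defined bijection from $\mathcal{O}^\tau_+$ onto the set of positive invertible elements. 4. If $\mathscr{A}$ is finite-dimensional, then $\mathcal{O}^\tau_+$ is the set of all faithful positive linear functionals on $\mathscr{A}$.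 -/

import Mathlib

open scoped Manifold ContDiff ComplexOrder

universe u

section Manifolds

/-- A subset `S` of a smooth real Banach manifold `M` modelled on `E` is a (split) Banach
submanifold if around each of its points there is a chart of `M` in which `S` is the trace of a
closed complemented linear subspace of `E`. -/
def IsBanachSubmanifold (E : Type*) [NormedAddCommGroup E] [NormedSpace ℝ E]
    {M : Type*} [TopologicalSpace M] [ChartedSpace E M] (S : Set M) : Prop :=
  ∀ x ∈ S, ∃ φ ∈ IsManifold.maximalAtlas 𝓘(ℝ, E) ∞ M, x ∈ φ.source ∧
    ∃ F : Submodule ℝ E, F.ClosedComplemented ∧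
      φ.source ∩ S = φ.source ∩ φ ⁻¹' (F : Set E)

/-- A Banach-Lie subgroup of a Banach-Lie group `G` (modelled on `EG`): a subgroup that is also a
Banach submanifold. -/
def IsBanachLieSubgroup (EG : Type*) [NormedAddCommGroup EG] [NormedSpace ℝ EG]
    {G : Type*} [Group G] [TopologicalSpace G] [ChartedSpace EG G] (K : Subgroup G) : Prop :=
  IsBanachSubmanifold EG (K : Set G)

/-- The manifold structure of the coset space `G ⧸ K`: a charted space structure (modelled on `E`,
compatible with the quotient topology) is the structure of smooth homogeneous space of `G` if
it makes `G ⧸ K` a smooth Hausdorff manifold for which the canonical projection is a smooth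
submersion and left translation is a smooth action of `G`. -/
structure IsSmoothCosetSpace (EG : Type*) [NormedAddCommGroup EG] [NormedSpace ℝ EG]
    (E : Type*) [NormedAddCommGroup E] [NormedSpace ℝ E]
    {G : Type*} [Group G] [TopologicalSpace G] [ChartedSpace EG G] (K : Subgroup G)
    [ChartedSpace E (G ⧸ K)] : Prop where
  isManifold : IsManifold 𝓘(ℝ, E) ∞ (G ⧸ K)
  t2Space : T2Space (G ⧸ K)
  isSubmersion : Manifold.IsSubmersion 𝓘(ℝ, EG) 𝓘(ℝ, E) ∞ (fun g : G => (g : G ⧸ K))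
  smooth_action : ContMDiffSMul 𝓘(ℝ, EG) 𝓘(ℝ, E) ∞ G (G ⧸ K)

/-- The map `g ↦ g • s` from a group onto the orbit of `s`. -/
def toOrbit (G : Type*) [Group G] {S : Type*} [MulAction G S] (s : S) (g : G) :
    MulAction.orbit G s :=
  ⟨g • s, MulAction.mem_orbit s g⟩

/-- Let a Banach-Lie group `G` act on a set `S`. A topology and charted space structure (modelled
on `E`) on the orbit through `s` is a structure of smooth homogeneous Banach manifold of `G` if the
isotropy group of `s` is a Banach-Lie subgroup of `G` and the canonical bijection
`[g] ↦ g • s` from the coset space by the isotropy group, with its smooth manifold structure, to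
the orbit is a diffeomorphism. We also record that the map `g ↦ g • s` onto the
orbit is then a smooth submersion and that `G` acts smoothly on the orbit. -/
structure IsHomogeneousOrbit (EG : Type*) [NormedAddCommGroup EG] [NormedSpace ℝ EG]
    (E : Type*) [NormedAddCommGroup E] [NormedSpace ℝ E]
    (G : Type*) [Group G] [TopologicalSpace G] [ChartedSpace EG G]
    {S : Type*} [MulAction G S] (s : S)
    [TopologicalSpace (MulAction.orbit G s)] [ChartedSpace E (MulAction.orbit G s)] : Prop where
  isManifold : IsManifold 𝓘(ℝ, E) ∞ (MulAction.orbit G s)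
  t2Space : T2Space (MulAction.orbit G s)
  isBanachLieSubgroup : IsBanachLieSubgroup EG (MulAction.stabilizer G s)
  exists_diffeomorph : ∃ _ : ChartedSpace E (G ⧸ MulAction.stabilizer G s),
    IsSmoothCosetSpace EG E (MulAction.stabilizer G s) ∧
    ∃ Φ : Diffeomorph 𝓘(ℝ, E) 𝓘(ℝ, E) (G ⧸ MulAction.stabilizer G s) (MulAction.orbit G s) ∞,
      ∀ g : G, Φ (g : G ⧸ MulAction.stabilizer G s) = toOrbit G s g
  isSubmersion : Manifold.IsSubmersion 𝓘(ℝ, EG) 𝓘(ℝ, E) ∞ (toOrbit G s)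
  smooth_action : ContMDiffSMul 𝓘(ℝ, EG) 𝓘(ℝ, E) ∞ G (MulAction.orbit G s)

end Manifolds

section Functionals

variable {A : Type*} [CStarAlgebra A]

/-- Positive elements of a C*-algebra: those of the form `b b†`. -/
def IsPositiveElement (a : A) : Prop := ∃ b : A, a = b * star b

/-- The set of positive invertible elements. -/
def positiveInvertibles (A : Type*) [CStarAlgebra A] : Set A :=
  {a | IsUnit a ∧ IsPositiveElement a}

/-- A continuous linear functional is self-adjoint if `ρ(a†)` is the conjugate of `ρ(a)`. -/
def IsSelfAdjointFunctional (ρ : StrongDual ℂ A) : Prop :=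
  ∀ a : A, ρ (star a) = starRingEnd ℂ (ρ a)

/-- The set of self-adjoint continuous linear functionals on `A`. -/
def SelfAdjointDual (A : Type*) [CStarAlgebra A] : Type _ :=
  {ρ : StrongDual ℂ A // IsSelfAdjointFunctional ρ}

/-- Positive linear functionals. -/
def IsPositiveFunctional (ρ : StrongDual ℂ A) : Prop :=
  ∀ a : A, 0 ≤ ρ (star a * a)

/-- A functional is faithful if it is strictly positive on nonzero positive elements. -/
def IsFaithfulFunctional (ρ : StrongDual ℂ A) : Prop :=
  ∀ a : A, IsPositiveElement a → a ≠ 0 → 0 < ρ a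

/-- A faithful finite trace. -/
structure IsFaithfulFiniteTrace (τ : StrongDual ℂ A) : Prop where
  positive : IsPositiveFunctional τ
  faithful : IsFaithfulFunctional τ
  trace : ∀ a b : A, τ (a * b) = τ (b * a)

/-- Positive linear functionals are self-adjoint. -/
theorem IsPositiveFunctional.isSelfAdjoint {ρ : StrongDual ℂ A} (h : IsPositiveFunctional ρ) :
    IsSelfAdjointFunctional ρ := by
  intro a
  have im0 : ∀ x : A, (ρ (star x * x)).im = 0 := fun x => (Complex.nonneg_iff.mp (h x)).2.symm
  have e0 := im0 1
  have ea := im0 a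
  have e1 := im0 (1 + a)
  have e2 := im0 (1 + Complex.I • a)
  simp only [star_add, star_one, star_smul, add_mul, mul_add, one_mul, mul_one, map_add,
    Complex.add_im, smul_mul_assoc, mul_smul_comm, map_smul, smul_eq_mul, Complex.mul_im,
    Complex.mul_re, Complex.star_def, Complex.conj_I, Complex.neg_re, Complex.neg_im, Complex.I_re,
    Complex.I_im] at e0 ea e1 e2
  apply Complex.ext
  · rw [Complex.conj_re]; linarith
  · rw [Complex.conj_im]; linarith

/-- A faithful finite trace, as a self-adjoint functional. -/
def IsFaithfulFiniteTrace.toSelfAdjointDual {τ : StrongDual ℂ A} (h : IsFaithfulFiniteTrace τ) :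
    SelfAdjointDual A :=
  ⟨τ, h.positive.isSelfAdjoint⟩

/-- The functional `b ↦ ρ(a† b a)`. -/
noncomputable def conjFunctional (a : A) (ρ : StrongDual ℂ A) : StrongDual ℂ A :=
  ρ.comp ((ContinuousLinearMap.mul ℂ A (star a)).comp ((ContinuousLinearMap.mul ℂ A).flip a))

theorem conjFunctional_apply (a : A) (ρ : StrongDual ℂ A) (b : A) :
    conjFunctional a ρ b = ρ (star a * (b * a)) := rfl

theorem IsSelfAdjointFunctional.conj {ρ : StrongDual ℂ A} (h : IsSelfAdjointFunctional ρ) (a : A) :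
    IsSelfAdjointFunctional (conjFunctional a ρ) := by
  intro b
  rw [conjFunctional_apply, conjFunctional_apply, ← h]
  simp [mul_assoc]

/-- The left action `α` of the group of invertible elements on the self-adjoint functionals:
`α(g, ξ)(b) = ξ(g† b g)`. -/
noncomputable instance SelfAdjointDual.alphaAction : MulAction Aˣ (SelfAdjointDual A) where
  smul g ξ := ⟨conjFunctional (g : A) ξ.1, ξ.2.conj (g : A)⟩
  one_smul ξ := by
    apply Subtype.ext
    ext b
    change conjFunctional ((1 : Aˣ) : A) ξ.1 b = ξ.1 b
    simp [conjFunctional_apply]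
  mul_smul g h ξ := by
    apply Subtype.ext
    ext b
    change conjFunctional ((g * h : Aˣ) : A) ξ.1 b =
      conjFunctional (g : A) (conjFunctional (h : A) ξ.1) b
    simp [conjFunctional_apply, mul_assoc]

theorem SelfAdjointDual.alpha_apply (g : Aˣ) (ξ : SelfAdjointDual A) (b : A) :
    (g • ξ).1 b = ξ.1 (star (g : A) * b * (g : A)) := by
  rw [mul_assoc]; rfl

/-- The Lie algebra of a closed subgroup `K` of the Banach-Lie group of invertible elements of `A`,
inside the Lie algebra `A` of that group: the elements `a` with `exp(t a) ∈ K` for all real `t`. -/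
def lieAlgebraOf (K : Subgroup Aˣ) : Set A :=
  {a | ∀ t : ℝ, ∃ u ∈ K, (u : A) = NormedSpace.exp (t • a)}

end Functionals

/-! Since `τ` is a trace, `α(g, τ)(b) = τ(g g† b)`, and since it is faithful, `x ↦ τ(x ·)` is
injective. So `α(g, τ)` and `g g†` determine each other: the isotropy group is the unitary group,
and both the orbit and the coset space are copies of `{g g†}`, which is the set of positive
invertibles (`positiveInvertibles_eq`).

All the geometry comes from the map `a ↦ a a†` into the self-adjoint elements. Its derivative at an
invertible `g`, paired with the skew part of `g⁻¹ h`, is an isomorphism of `A` onto self-adjoint ×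
skew-adjoint (`gramDerivEquiv`). The inverse function theorem then makes the map open on `Aˣ`, its
level sets split submanifolds, and the map itself a submersion. The orbit and the coset space thus
embed as the same open set of self-adjoint elements; with that embedding as single chart, the
bijection between them reads as the identity and the action as `(g, x) ↦ g x g†`.

In finite dimension every functional is `τ(a ·)`, and it remains to see that positivity and
faithfulness make `a` positive and invertible. -/

open scoped Topology

/-! ### Submersions and submanifolds from the inverse function theorem. -/

section Submersions

variable {E : Type*} [NormedAddCommGroup E] [NormedSpace ℝ E]
  {E' : Type*} [NormedAddCommGroup E'] [NormedSpace ℝ E']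
  {F : Type*} [NormedAddCommGroup F] [NormedSpace ℝ F]

/-- Inverse function theorem: a map with bijective derivative at `x` is, up to a local
diffeomorphism of the domain, a linear isomorphism. -/
theorem exists_mem_contDiffGroupoid_of_hasFDerivAt_equiv [CompleteSpace E] {f : E → E'} {x : E}
    (hf : ContDiffAt ℝ ω f x) (L : E ≃L[ℝ] E') (hL : HasFDerivAt f (L : E →L[ℝ] E') x) :
    ∃ φ ∈ contDiffGroupoid ∞ 𝓘(ℝ, E), x ∈ φ.source ∧ ∀ y ∈ φ.source, L (φ y) = f y := by
  set Φ := hf.toOpenPartialHomeomorph f hL (by simp) with hΦ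
  have hx : x ∈ Φ.source := hf.mem_toOpenPartialHomeomorph_source hL (by simp)
  have hsymm : ContDiffAt ℝ ω Φ.symm (f x) := hf.to_localInverse hL (by simp)
  -- Order `ω` matters: unlike order `∞`, it passes from a point to a neighbourhood.
  have h₁ : {y | ContDiffAt ℝ ω f y} ∈ 𝓝 x := hf.eventually (by simp)
  have h₂ : {y | ContDiffAt ℝ ω Φ.symm (f y)} ∈ 𝓝 x :=
    hf.continuousAt (hsymm.eventually (by simp))
  obtain ⟨s, hs, hso, hxs⟩ := mem_nhds_iff.1 (Filter.inter_mem h₁ h₂)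
  set Ψ := Φ.restrOpen s hso with hΨ
  refine ⟨Ψ.trans L.symm.toHomeomorph.toOpenPartialHomeomorph, ?_, ?_, ?_⟩
  · rw [contDiffGroupoid, mem_groupoid_of_pregroupoid]
    simp only [contDiffPregroupoid]
    constructor
    · intro y hy
      have hy' : y ∈ s := by
        have := hy.1
        simp [hΨ] at this
        exact this.2
      have : ContDiffAt ℝ ω (fun z => L.symm (f z)) y :=
        L.symm.contDiff.contDiffAt.comp y (hs hy').1
      exact (this.of_le le_top).contDiffWithinAt
    · intro y hy
      have hy' : L y ∈ Ψ.target := by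
        have := hy.1
        simpa using this
      have hy'' : Φ.symm (L y) ∈ s ∧ L y ∈ Φ.target := by
        simp [hΨ] at hy'
        grind
      have h3 := (hs hy''.1).2
      have h4 : f (Φ.symm (L y)) = L y := Φ.right_inv hy''.2
      rw [Set.mem_ofPred_eq, h4] at h3
      have : ContDiffAt ℝ ω (fun z => Φ.symm (L z)) y :=
        h3.comp y L.contDiff.contDiffAt
      exact (this.of_le le_top).contDiffWithinAt
  · simpa [hΨ] using ⟨hx, hxs⟩
  · intro y _
    exact L.apply_symm_apply _

theorem IsManifold.trans_mem_maximalAtlas {M : Type*} [TopologicalSpace M] [ChartedSpace E M]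
    [IsManifold 𝓘(ℝ, E) ∞ M] (x : M) {φ : OpenPartialHomeomorph E E}
    (hφ : φ ∈ contDiffGroupoid ∞ 𝓘(ℝ, E)) :
    (chartAt E x).trans φ ∈ IsManifold.maximalAtlas 𝓘(ℝ, E) ∞ M := by
  rw [IsManifold.mem_maximalAtlas_iff]
  intro e he
  have h₁ := (contDiffGroupoid ∞ 𝓘(ℝ, E)).compatible (chart_mem_atlas E x) he
  have h₂ := (contDiffGroupoid ∞ 𝓘(ℝ, E)).compatible he (chart_mem_atlas E x)
  constructor
  · rw [OpenPartialHomeomorph.trans_symm_eq_symm_trans_symm, OpenPartialHomeomorph.trans_assoc]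
    exact (contDiffGroupoid ∞ 𝓘(ℝ, E)).trans ((contDiffGroupoid ∞ 𝓘(ℝ, E)).symm hφ) h₁
  · rw [← OpenPartialHomeomorph.trans_assoc]
    exact (contDiffGroupoid ∞ 𝓘(ℝ, E)).trans h₂ hφ

/-- A map between manifolds is a submersion at `x` if, read in a chart at the source and an open
embedding of the target in a vector space, it extends to a map with a bijective derivative. -/
theorem Manifold.IsSubmersionAtOfComplement.of_hasFDerivAt_equiv [CompleteSpace E]
    {M : Type*} [TopologicalSpace M] [ChartedSpace E M] [IsManifold 𝓘(ℝ, E) ∞ M]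
    {N : Type*} [TopologicalSpace N] {j : N → E'} (hj : Topology.IsOpenEmbedding j) [Nonempty N]
    {f : M → N} {x : M} (hfx : ContinuousAt f x) {p : E → E'} {q : E → F}
    (hp : ContDiffAt ℝ ω p (chartAt E x x)) (hq : ContDiffAt ℝ ω q (chartAt E x x))
    (hpf : ∀ y ∈ (chartAt E x).source, p (chartAt E x y) = j (f y))
    (L : E ≃L[ℝ] E' × F)
    (hL : HasFDerivAt (fun y => (p y, q y)) (L : E →L[ℝ] E' × F) (chartAt E x x)) :
    letI := hj.singletonChartedSpace
    IsSubmersionAtOfComplement F 𝓘(ℝ, E) 𝓘(ℝ, E') ∞ f x := by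
  let := hj.singletonChartedSpace
  have := hj.isManifold_singleton (I := 𝓘(ℝ, E')) (n := ∞)
  obtain ⟨φ, hφ, hxφ, hLφ⟩ :=
    exists_mem_contDiffGroupoid_of_hasFDerivAt_equiv (hp.prodMk hq) L hL
  -- In the chart corrected by `φ`, the map reads as `L` followed by the first projection.
  refine mk_of_continuousAt hfx L ((chartAt E x).trans φ) (chartAt E' (f x)) (by simpa using hxφ)
    (mem_chart_source _ _) (IsManifold.trans_mem_maximalAtlas x hφ)
    (IsManifold.chart_mem_maximalAtlas _) ?_
  intro y hy
  have hy' : y ∈ φ.target ∧ φ.symm y ∈ (chartAt E x).target := by simpa using hy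
  have h1 : j (f ((chartAt E x).symm (φ.symm y))) = p (φ.symm y) := by
    rw [← hpf _ ((chartAt E x).map_target hy'.2), (chartAt E x).right_inv hy'.2]
  have h2 := congrArg Prod.fst (hLφ _ (φ.map_target hy'.1))
  rw [φ.right_inv hy'.1] at h2
  exact h1.trans h2.symm

/-- The zero set of a map that is part of a map with bijective derivative is locally flattened by
a chart onto a complemented subspace. -/
theorem exists_chart_preimage_zero_eq [CompleteSpace E]
    {M : Type*} [TopologicalSpace M] [ChartedSpace E M] [IsManifold 𝓘(ℝ, E) ∞ M]
    {x : M} {p : E → E'} {q : E → F}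
    (hp : ContDiffAt ℝ ω p (chartAt E x x)) (hq : ContDiffAt ℝ ω q (chartAt E x x))
    (L : E ≃L[ℝ] E' × F)
    (hL : HasFDerivAt (fun y => (p y, q y)) (L : E →L[ℝ] E' × F) (chartAt E x x)) :
    ∃ φ ∈ IsManifold.maximalAtlas 𝓘(ℝ, E) ∞ M, x ∈ φ.source ∧
      ∃ V : Submodule ℝ E, V.ClosedComplemented ∧
        ∀ y ∈ φ.source, φ y ∈ V ↔ p (chartAt E x y) = 0 := by
  obtain ⟨φ, hφ, hxφ, hLφ⟩ :=
    exists_mem_contDiffGroupoid_of_hasFDerivAt_equiv (hp.prodMk hq) L hL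
  let π : E →L[ℝ] E' := (ContinuousLinearMap.fst ℝ E' F).comp (L : E →L[ℝ] E' × F)
  refine ⟨(chartAt E x).trans φ, IsManifold.trans_mem_maximalAtlas x hφ, by simpa using hxφ,
    LinearMap.ker (π : E →ₗ[ℝ] E'), ?_, ?_⟩
  · exact ContinuousLinearMap.closedComplemented_ker_of_rightInverse π
      ((L.symm : E' × F →L[ℝ] E).comp (ContinuousLinearMap.inl ℝ E' F)) fun y => by simp [π]
  · intro y hy
    have h2 := congrArg Prod.fst (hLφ _ hy.2)
    change (L (φ (chartAt E x y))).1 = 0 ↔ _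
    rw [show (L (φ (chartAt E x y))).1 = p (chartAt E x y) from h2]

/-- In the single chart given by an open embedding, that embedding has the identity as
derivative. -/
theorem Topology.IsOpenEmbedding.hasMFDerivAt {N : Type*} [TopologicalSpace N] [Nonempty N]
    {j : N → E'} (hj : Topology.IsOpenEmbedding j) (x : N) :
    letI := hj.singletonChartedSpace
    HasMFDerivAt 𝓘(ℝ, E') 𝓘(ℝ, E') j x (ContinuousLinearMap.id ℝ E') := by
  let := hj.singletonChartedSpace
  refine ⟨hj.continuous.continuousAt, ?_⟩
  refine (hasFDerivWithinAt_id _ _).congr_of_eventuallyEq ?_ ?_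
  · refine Filter.Eventually.filter_mono nhdsWithin_le_nhds ?_
    filter_upwards [hj.isOpen_range.mem_nhds (Set.mem_range_self x)]
    rintro _ ⟨y, rfl⟩
    exact congrArg j (hj.toOpenPartialHomeomorph_left_inv j)
  · exact congrArg j (hj.toOpenPartialHomeomorph_left_inv j)

end Submersions

/-! ### The map `a ↦ a a†` and its derivative. -/

section GramMap

variable {A : Type*} [CStarAlgebra A]

noncomputable instance skewAdjoint.normedSpaceReal : NormedSpace ℝ (skewAdjoint A) where
  norm_smul_le r x := norm_smul_le r (x : A)

/-- The inclusion of the self-adjoint elements, as a continuous real-linear map. -/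
noncomputable def selfAdjoint.realSubtypeL (A : Type*) [CStarAlgebra A] : selfAdjoint A →L[ℝ] A :=
  (selfAdjoint.submodule ℝ A).subtypeL

instance selfAdjoint.completeSpace : CompleteSpace (selfAdjoint A) :=
  (isClosed_eq continuous_star continuous_id).completeSpace_coe

/-- The map `a ↦ a a†` into the self-adjoint elements. -/
def gramMap (a : A) : selfAdjoint A := ⟨a * star a, IsSelfAdjoint.mul_star_self a⟩

theorem coe_gramMap (a : A) : (gramMap a : A) = a * star a := rfl

/-- Factoring through a continuous linear projection lets the calculus rules of `A` apply to a map
into a subtype. -/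
theorem gramMap_eq (a : A) : gramMap a = selfAdjointPartL ℝ A (a * star a) :=
  ((IsSelfAdjoint.mul_star_self a).selfAdjointPart_apply ℝ).symm

theorem contDiff_gramMap {n : WithTop ℕ∞} : ContDiff ℝ n (gramMap : A → selfAdjoint A) := by
  rw [funext gramMap_eq]
  exact (selfAdjointPartL ℝ A).contDiff.comp (contDiff_id.mul (starL' ℝ : A ≃L[ℝ] A).contDiff)

/-- The derivative of `gramMap` at `a`. -/
noncomputable def gramDeriv (a : A) : A →L[ℝ] selfAdjoint A :=
  (selfAdjointPartL ℝ A).comp (a • ((starL' ℝ : A ≃L[ℝ] A) : A →L[ℝ] A) +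
    MulOpposite.op (star a) • ContinuousLinearMap.id ℝ A)

theorem coe_gramDeriv (a h : A) : (gramDeriv a h : A) = a * star h + h * star a := by
  have : IsSelfAdjoint (a * star h + h * star a) := by
    simp [isSelfAdjoint_iff, add_comm]
  exact this.coe_selfAdjointPart_apply ℝ

theorem hasFDerivAt_gramMap (a : A) : HasFDerivAt gramMap (gramDeriv a) a := by
  rw [funext gramMap_eq]
  exact (selfAdjointPartL ℝ A).hasFDerivAt.comp a
    ((hasFDerivAt_id a).mul' (starL' ℝ : A ≃L[ℝ] A).hasFDerivAt)

/-- The derivative of `gramMap` at an invertible element, completed to an isomorphism. -/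
noncomputable def gramDerivEquiv (g : Aˣ) : A ≃L[ℝ] selfAdjoint A × skewAdjoint A :=
  ContinuousLinearEquiv.equivOfInverse
    ((gramDeriv (g : A)).prod
      ((skewAdjointPartL ℝ A).comp (ContinuousLinearMap.mul ℝ A ((g⁻¹ : Aˣ) : A))))
    -- With `h = g k`, the first component is `x = g (k + k†) g†` and the second is the skew part
    -- `y` of `k`. Hence `k = ½ g⁻¹ x (g†)⁻¹ + y`, and `h = g k` is the inverse below.
    (((1 / 2 : ℝ) • (MulOpposite.op (star ((g⁻¹ : Aˣ) : A)) •
        selfAdjoint.realSubtypeL A)).coprod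
      ((g : A) • ((skewAdjoint.submodule ℝ A).subtypeL : skewAdjoint A →L[ℝ] A)))
    (by
      intro h
      change (1 / 2 : ℝ) • ((gramDeriv (g : A) h : A) * star ((g⁻¹ : Aˣ) : A)) +
        (g : A) * (skewAdjointPart ℝ (((g⁻¹ : Aˣ) : A) * h) : A) = h
      rw [coe_gramDeriv, skewAdjointPart_apply_coe, add_mul, mul_assoc h, ← star_mul,
        Units.inv_mul, star_one, mul_one, mul_smul_comm, mul_sub, Units.mul_inv_cancel_left,
        star_mul, invOf_eq_inv, ← mul_assoc]
      module)
    (by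
      rintro ⟨x, y⟩
      have hx : star (x : A) = x := x.2
      have hy : star (y : A) = -y := y.2
      set h : A := (1 / 2 : ℝ) • ((x : A) * star ((g⁻¹ : Aˣ) : A)) + (g : A) * y with hh
      have hs : star h = (1 / 2 : ℝ) • (((g⁻¹ : Aˣ) : A) * x) - (y : A) * star (g : A) := by
        rw [hh, star_add, star_smul, star_mul, star_mul, star_star, hx, hy, star_trivial,
          neg_mul, sub_eq_add_neg]
      have hg : star ((g⁻¹ : Aˣ) : A) * star (g : A) = 1 := by
        rw [← star_mul, Units.mul_inv, star_one]
      change (gramDeriv (g : A) h, skewAdjointPart ℝ (((g⁻¹ : Aˣ) : A) * h)) = (x, y)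
      refine Prod.ext (Subtype.ext ?_) (Subtype.ext ?_)
      · change (gramDeriv (g : A) h : A) = x
        rw [coe_gramDeriv, hs, hh, mul_sub, mul_smul_comm, Units.mul_inv_cancel_left, add_mul,
          smul_mul_assoc, mul_assoc (x : A), hg, mul_one, mul_assoc]
        module
      · change (skewAdjointPart ℝ (((g⁻¹ : Aˣ) : A) * h) : A) = y
        rw [skewAdjointPart_apply_coe, star_mul, hs, hh, mul_add, sub_mul, mul_smul_comm,
          smul_mul_assoc, Units.inv_mul_cancel_left, mul_assoc (y : A), ← star_mul,
          Units.inv_mul, star_one, mul_one, invOf_eq_inv, mul_assoc]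
        module)

theorem hasFDerivAt_gramMap_prodMk (g : Aˣ) (c : selfAdjoint A) :
    HasFDerivAt (fun a : A => (gramMap a - c, skewAdjointPartL ℝ A (((g⁻¹ : Aˣ) : A) * a)))
      (gramDerivEquiv g : A →L[ℝ] selfAdjoint A × skewAdjoint A) (g : A) :=
  ((hasFDerivAt_gramMap (g : A)).sub_const c).prodMk
    ((skewAdjointPartL ℝ A).hasFDerivAt.comp _
      (ContinuousLinearMap.mul ℝ A ((g⁻¹ : Aˣ) : A)).hasFDerivAt)

theorem contDiff_skewAdjointPart_mul {n : WithTop ℕ∞} (b : A) :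
    ContDiff ℝ n fun a : A => skewAdjointPartL ℝ A (b * a) :=
  (skewAdjointPartL ℝ A).contDiff.comp (ContinuousLinearMap.mul ℝ A b).contDiff

/-- The map `g ↦ g g†` from the invertible elements into the self-adjoint elements. -/
def gramUnits (g : Aˣ) : selfAdjoint A := gramMap (g : A)

theorem continuous_gramUnits : Continuous (gramUnits : Aˣ → selfAdjoint A) :=
  (contDiff_gramMap (n := 0)).continuous.comp Units.continuous_val

/-- A surjective strict derivative maps neighbourhoods onto neighbourhoods, and `Aˣ` is open in `A`.
-/
theorem isOpenMap_gramUnits : IsOpenMap (gramUnits : Aˣ → selfAdjoint A) := by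
  rw [isOpenMap_iff_nhds_le]
  intro g
  have h : HasStrictFDerivAt gramMap (gramDeriv (g : A)) (g : A) :=
    (contDiff_gramMap (n := 1)).contDiffAt.hasStrictFDerivAt' (hasFDerivAt_gramMap _) (by simp)
  have hsurj : (gramDeriv (g : A)).range = ⊤ := by
    refine LinearMap.range_eq_top.2 fun x => ?_
    obtain ⟨h, hh⟩ := (gramDerivEquiv g).surjective (x, 0)
    exact ⟨h, congrArg Prod.fst hh⟩
  have := h.map_nhds_eq_of_surj hsurj
  rw [gramUnits, ← this, ← Units.isOpenEmbedding_val.map_nhds_eq, Filter.map_map]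
  rfl

/-- The level sets of `g ↦ g g†` are Banach submanifolds of the group of invertible elements. -/
theorem isBanachSubmanifold_gramUnits_eq (c : selfAdjoint A) :
    IsBanachSubmanifold A {g : Aˣ | gramUnits g = c} := by
  intro g hg
  obtain ⟨φ, hφ, hgφ, V, hV, h⟩ := exists_chart_preimage_zero_eq (M := Aˣ) (x := g)
    (p := fun a => gramMap a - c)
    (contDiff_gramMap.sub contDiff_const).contDiffAt
    (contDiff_skewAdjointPart_mul ((g⁻¹ : Aˣ) : A)).contDiffAt (gramDerivEquiv g)
    (hasFDerivAt_gramMap_prodMk g c)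
  refine ⟨φ, hφ, hgφ, V, hV, ?_⟩
  ext y
  refine and_congr_right fun hy => ((h y hy).trans sub_eq_zero).symm

theorem isSubmersion_of_gramUnits {N : Type*} [TopologicalSpace N] [Nonempty N]
    {j : N → selfAdjoint A} (hj : Topology.IsOpenEmbedding j) {f : Aˣ → N}
    (hf : ∀ g, j (f g) = gramUnits g) :
    letI := hj.singletonChartedSpace
    Manifold.IsSubmersion 𝓘(ℝ, A) 𝓘(ℝ, selfAdjoint A) ∞ f := by
  let := hj.singletonChartedSpace
  refine Manifold.IsSubmersionOfComplement.isSubmersion (F := skewAdjoint A) fun g => ?_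
  have hfc : Continuous f := by
    rw [hj.isInducing.continuous_iff]
    exact continuous_gramUnits.congr fun g => (hf g).symm
  refine .of_hasFDerivAt_equiv hj hfc.continuousAt (p := gramMap) contDiff_gramMap.contDiffAt
    (contDiff_skewAdjointPart_mul ((g⁻¹ : Aˣ) : A)).contDiffAt (fun y _ => (hf y).symm)
    (gramDerivEquiv g) ?_
  simpa using hasFDerivAt_gramMap_prodMk g 0

/-- As `j` has derivative the identity in its own chart, the derivative of `f` at `1` is that of `a
↦ a a†`, namely `a ↦ a† + a`. -/
theorem mfderiv_eq_zero_iff_of_gramUnits {N : Type*} [TopologicalSpace N] [Nonempty N]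
    {j : N → selfAdjoint A} (hj : Topology.IsOpenEmbedding j) {f : Aˣ → N}
    (hf : ∀ g, j (f g) = gramUnits g) (a : A) :
    letI := hj.singletonChartedSpace
    mfderiv 𝓘(ℝ, A) 𝓘(ℝ, selfAdjoint A) f 1 (a : TangentSpace 𝓘(ℝ, A) (1 : Aˣ)) = 0 ↔
      star a = -a := by
  let := hj.singletonChartedSpace
  have h₁ : HasMFDerivAt 𝓘(ℝ, A) 𝓘(ℝ, selfAdjoint A) (j ∘ f) 1
      ((ContinuousLinearMap.id ℝ (selfAdjoint A)).comp
        (mfderiv 𝓘(ℝ, A) 𝓘(ℝ, selfAdjoint A) f 1)) :=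
    (hj.hasMFDerivAt (f 1)).comp 1
      (((isSubmersion_of_gramUnits hj hf).contMDiff.mdifferentiable (by simp)) 1).hasMFDerivAt
  have h₂ : HasMFDerivAt 𝓘(ℝ, A) 𝓘(ℝ, selfAdjoint A) (gramMap ∘ (Units.val : Aˣ → A)) 1
      ((gramDeriv ((1 : Aˣ) : A)).comp (ContinuousLinearMap.id ℝ A)) :=
    (hasFDerivAt_gramMap ((1 : Aˣ) : A)).hasMFDerivAt.comp (1 : Aˣ)
      (Units.isOpenEmbedding_val.hasMFDerivAt (1 : Aˣ))
  have h₃ : j ∘ f = gramMap ∘ (Units.val : Aˣ → A) := funext hf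
  rw [h₃] at h₁
  have h₄ : mfderiv 𝓘(ℝ, A) 𝓘(ℝ, selfAdjoint A) f 1 a = gramDeriv 1 a :=
    have h₅ := hasMFDerivAt_unique h₁ h₂
    congrArg (fun T : A →L[ℝ] selfAdjoint A => T a) h₅
  rw [h₄]
  change gramDeriv (1 : A) a = (0 : selfAdjoint A) ↔ _
  rw [← Subtype.coe_inj, coe_gramDeriv, one_mul, star_one, mul_one, ZeroMemClass.coe_zero,
    add_eq_zero_iff_eq_neg]

/-- If the action of the invertible elements on `N` becomes `(g, x) ↦ g x g†` in an open
embedding of `N` into the self-adjoint elements, then it is smooth. -/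
theorem contMDiffSMul_of_conj {N : Type*} [TopologicalSpace N] [Nonempty N] [SMul Aˣ N]
    {j : N → selfAdjoint A} (hj : Topology.IsOpenEmbedding j)
    (h : ∀ (g : Aˣ) (x : N), (j (g • x) : A) = (g : A) * (j x : A) * star (g : A)) :
    letI := hj.singletonChartedSpace
    ContMDiffSMul 𝓘(ℝ, A) 𝓘(ℝ, selfAdjoint A) ∞ Aˣ N := by
  let := hj.singletonChartedSpace
  refine ⟨ContMDiff.of_comp_isOpenEmbedding hj ?_⟩
  -- The projection leaves the self-adjoint `g x g†` unchanged; it only makes `c` visibly smooth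
  -- into the subtype.
  let c : A × selfAdjoint A → selfAdjoint A := fun p =>
    selfAdjointPartL ℝ A (p.1 * (p.2 : A) * star p.1)
  have hc : ContDiff ℝ ∞ c :=
    (selfAdjointPartL ℝ A).contDiff.comp ((contDiff_fst.mul
      ((selfAdjoint.realSubtypeL A).contDiff.comp contDiff_snd)).mul
        ((starL' ℝ : A ≃L[ℝ] A).contDiff.comp contDiff_fst))
  have hcj : (j ∘ fun p : Aˣ × N => p.1 • p.2) = c ∘ fun p : Aˣ × N => ((p.1 : A), j p.2) := by
    funext p
    refine Subtype.ext ((h p.1 p.2).trans (Eq.symm ?_))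
    have : IsSelfAdjoint ((p.1 : A) * (j p.2 : A) * star (p.1 : A)) := (j p.2).2.conjugate _
    exact this.coe_selfAdjointPart_apply ℝ
  rw [hcj]
  exact hc.contMDiff.comp ((Units.contMDiff_val.comp contMDiff_fst).prodMk_space
    ((contMDiff_isOpenEmbedding hj).comp contMDiff_snd))

end GramMap

/-! ### Faithful traces: isotropy group, Lie algebra, finite-dimensional orbit. -/

section Functionals

variable {A : Type*} [CStarAlgebra A]

theorem isTopCompl_skewAdjoint_selfAdjoint :
    (skewAdjoint.submodule ℝ A).IsTopCompl (selfAdjoint.submodule ℝ A) := by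
  let f : A →L[ℝ] skewAdjoint.submodule ℝ A := skewAdjointPartL ℝ A
  have hf : ∀ x : A, (f x : A) = (⅟2 : ℝ) • (x - star x) := skewAdjointPart_apply_coe ℝ
  have hker : f.ker = selfAdjoint.submodule ℝ A := by
    ext x
    have : f x = 0 ↔ x - star x = 0 := by
      rw [← Subtype.coe_inj, hf, ZeroMemClass.coe_zero, smul_eq_zero, or_iff_right (by simp)]
    exact this.trans (sub_eq_zero.trans eq_comm)
  rw [← hker]
  refine ContinuousLinearMap.isTopCompl_of_proj fun x => Subtype.ext ?_
  have hx : star (x : A) = -x := x.2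
  rw [hf, hx, invOf_eq_inv]
  module

/-- For the nontrivial inclusion, `g` is the positive square root of `a`, invertible because `a` is.
-/
theorem positiveInvertibles_eq :
    positiveInvertibles A = {a : A | ∃ g : Aˣ, a = (g : A) * star (g : A)} := by
  let := CStarAlgebra.spectralOrder A
  have := CStarAlgebra.spectralOrderedRing A
  ext a
  constructor
  · rintro ⟨hu, b, hb⟩
    have ha : 0 ≤ a := hb ▸ mul_star_self_nonneg b
    obtain ⟨g, hg⟩ := (CFC.isUnit_sqrt_iff a).2 hu
    have hs : star (CFC.sqrt a) = CFC.sqrt a := (CFC.sqrt_nonneg a).isSelfAdjoint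
    exact ⟨g, by rw [hg, hs, CFC.sqrt_mul_sqrt_self a]⟩
  · rintro ⟨g, rfl⟩
    exact ⟨g.isUnit.mul g.isUnit.star, _, rfl⟩

theorem IsFaithfulFunctional.eq_zero_of_mul_star_self {ρ : StrongDual ℂ A}
    (hρ : IsFaithfulFunctional ρ) {x : A} (hx : ρ (x * star x) = 0) : x = 0 := by
  by_contra h
  exact (hρ (x * star x) ⟨x, rfl⟩ (by rwa [Ne, CStarRing.mul_star_self_eq_zero_iff])).ne' hx

namespace IsFaithfulFiniteTrace

variable {τ : StrongDual ℂ A} (hτ : IsFaithfulFiniteTrace τ)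
include hτ

/-- Testing with `b = (x - y)†` reduces this to faithfulness. -/
theorem eq_of_forall_apply_mul_eq {x y : A} (h : ∀ b, τ (x * b) = τ (y * b)) : x = y := by
  rw [← sub_eq_zero]
  refine hτ.faithful.eq_zero_of_mul_star_self ?_
  rw [sub_mul, map_sub, h, sub_self]

theorem smul_apply (g : Aˣ) (b : A) :
    (g • hτ.toSelfAdjointDual).1 b = τ ((g : A) * star (g : A) * b) := by
  rw [SelfAdjointDual.alpha_apply, mul_assoc (g : A), hτ.trace (g : A)]
  rfl

theorem smul_eq_smul_iff (g h : Aˣ) :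
    g • hτ.toSelfAdjointDual = h • hτ.toSelfAdjointDual ↔ gramUnits g = gramUnits h := by
  constructor
  · intro H
    refine Subtype.ext (hτ.eq_of_forall_apply_mul_eq fun b => ?_)
    exact (hτ.smul_apply g b).symm.trans ((congrArg (fun ξ => ξ.1 b) H).trans (hτ.smul_apply h b))
  · intro H
    refine Subtype.ext (ContinuousLinearMap.ext fun b => ?_)
    rw [hτ.smul_apply, hτ.smul_apply, show (g : A) * star (g : A) = h * star (h : A) from
      congrArg Subtype.val H]

theorem mem_stabilizer_iff (g : Aˣ) :
    g ∈ MulAction.stabilizer Aˣ hτ.toSelfAdjointDual ↔ (g : A) * star (g : A) = 1 := by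
  rw [MulAction.mem_stabilizer_iff]
  have := hτ.smul_eq_smul_iff g 1
  rw [one_smul] at this
  rw [this, ← Subtype.coe_inj]
  simp [gramUnits, coe_gramMap]

/-- The isotropy group of a faithful finite trace has the skew-adjoint elements as Lie algebra. -/
theorem lieAlgebraOf_stabilizer :
    lieAlgebraOf (MulAction.stabilizer Aˣ hτ.toSelfAdjointDual) =
      (skewAdjoint.submodule ℝ A : Set A) := by
  ext a
  constructor
  · intro ha
    -- Differentiating `exp(ta) exp(ta)† = 1` at `t = 0` gives `a + a† = 0`.
    have h₁ : HasDerivAt (fun t : ℝ => NormedSpace.exp (t • a) * NormedSpace.exp (t • star a))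
        (a + star a) 0 := by
      have h := (hasDerivAt_exp_smul_const (𝕂 := ℝ) a 0).mul
        (hasDerivAt_exp_smul_const (𝕂 := ℝ) (star a) 0)
      simp only [zero_smul, NormedSpace.exp_zero, one_mul, mul_one] at h
      exact h
    have h₂ : (fun t : ℝ => NormedSpace.exp (t • a) * NormedSpace.exp (t • star a)) =
        fun _ => 1 := by
      funext t
      obtain ⟨u, hu, hut⟩ := ha t
      rw [hτ.mem_stabilizer_iff, hut, NormedSpace.star_exp, star_smul, star_trivial] at hu
      exact hu
    rw [h₂] at h₁
    exact eq_neg_of_add_eq_zero_right (h₁.unique (hasDerivAt_const _ _))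
  · intro ha t
    have hu : NormedSpace.exp (t • a) ∈ unitary A := by
      let := NormedAlgebra.restrictScalars ℚ ℝ A
      exact NormedSpace.exp_mem_unitary_of_mem_skewAdjoint
        ((skewAdjoint.submodule ℝ A).smul_mem t ha)
    exact ⟨Unitary.toUnits ⟨_, hu⟩, (hτ.mem_stabilizer_iff _).2 hu.2, rfl⟩

/-- In finite dimension the orbit of a faithful finite trace is the set of faithful positive
functionals. -/
theorem orbit_eq [FiniteDimensional ℂ A] :
    MulAction.orbit Aˣ hτ.toSelfAdjointDual =
      {ρ : SelfAdjointDual A | IsPositiveFunctional ρ.1 ∧ IsFaithfulFunctional ρ.1} := by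
  let := CStarAlgebra.spectralOrder A
  have := CStarAlgebra.spectralOrderedRing A
  ext ρ
  constructor
  · rintro ⟨g, rfl⟩
    -- The value is `τ(x† x)` with `x = b† g`; if it vanishes then `x = 0`, so `b = 0` as `g` is
    -- invertible.
    have key (b : A) : (g • hτ.toSelfAdjointDual).1 (b * star b) =
        τ (star (star b * (g : A)) * (star b * (g : A))) := by
      rw [SelfAdjointDual.alpha_apply]
      simp only [star_mul, star_star, mul_assoc]
      rfl
    have hpos (b : A) : 0 ≤ (g • hτ.toSelfAdjointDual).1 (b * star b) := by
      rw [key]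
      exact hτ.positive _
    refine ⟨fun b => by simpa using hpos (star b), ?_⟩
    rintro _ ⟨b, rfl⟩ hb
    refine lt_of_le_of_ne (hpos b) fun h => hb ?_
    rw [key, hτ.trace] at h
    have := hτ.faithful.eq_zero_of_mul_star_self h.symm
    rw [Units.mul_left_eq_zero, star_eq_zero] at this
    rw [this, zero_mul]
  · rintro ⟨hρ, hρf⟩
    -- The injection `x ↦ τ(x ·)` into a dual of equal dimension is onto, which yields a density `a`
    -- for `ρ`.
    let m : A →ₗ[ℂ] Module.Dual ℂ A :=
      (LinearMap.mul ℂ A).compr₂ (τ : A →ₗ[ℂ] ℂ)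
    have hm : Function.Injective m := fun x y h =>
      hτ.eq_of_forall_apply_mul_eq fun b => congrArg (fun f : Module.Dual ℂ A => f b) h
    obtain ⟨a, ha⟩ := (LinearMap.injective_iff_surjective_of_finrank_eq_finrank
      (Subspace.dual_finrank_eq (K := ℂ) (V := A)).symm).1 hm (ρ.1 : A →ₗ[ℂ] ℂ)
    replace ha (b : A) : ρ.1 b = τ (a * b) := (congrArg (fun f : Module.Dual ℂ A => f b) ha).symm
    have hsa : IsSelfAdjoint a := by
      refine hτ.eq_of_forall_apply_mul_eq fun b => ?_
      rw [← ha, ← star_star b, ← star_mul, hτ.positive.isSelfAdjoint, hτ.trace, ← ha, ρ.2]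
      simp
    -- Here `0 ≤ ρ(a⁻) = τ(a a⁻) = -τ((a⁻)²)`, so faithfulness of `τ` rules out `a⁻ ≠ 0`.
    have hneg : a⁻ = 0 := by
      by_contra hne
      have hn := CFC.negPart_nonneg a
      obtain ⟨c, hc⟩ := CStarAlgebra.nonneg_iff_eq_star_mul_self.1 hn
      have h₁ : 0 ≤ ρ.1 a⁻ := hc ▸ hρ c
      have h₂ : a * a⁻ = -(a⁻ * star a⁻) := by
        nth_rw 1 [← CFC.posPart_sub_negPart a hsa]
        rw [sub_mul, CFC.posPart_mul_negPart, zero_sub, hn.isSelfAdjoint.star_eq]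
      rw [ha, h₂, map_neg, neg_nonneg] at h₁
      exact (hτ.faithful (a⁻ * star a⁻) ⟨_, rfl⟩
        (by rwa [Ne, CStarRing.mul_star_self_eq_zero_iff])).not_ge h₁
    have hapos : 0 ≤ a := by
      rw [← CFC.posPart_sub_negPart a hsa, hneg, sub_zero]
      exact CFC.posPart_nonneg a
    -- In an Artinian ring it suffices that `b a = 0` forces `b = 0`: then `a b† = 0`, so `ρ(b† b) =
    -- τ(a b† b) = 0`, and `ρ` is faithful.
    have haunit : IsUnit a := by
      have := IsArtinianRing.of_finite ℂ A
      rw [IsArtinianRing.isUnit_iff_isRightRegular, isRightRegular_iff_left_eq_zero_of_mul]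
      intro b hb
      have hb' : a * star b = 0 := by
        rw [← hsa.star_eq, ← star_mul, hb, star_zero]
      have : star b = 0 := hρf.eq_zero_of_mul_star_self (by
        rw [ha, ← mul_assoc, hb', zero_mul, map_zero])
      rwa [star_eq_zero] at this
    have : a ∈ positiveInvertibles A :=
      ⟨haunit, CStarAlgebra.nonneg_iff_eq_mul_star_self.1 hapos⟩
    rw [positiveInvertibles_eq] at this
    obtain ⟨g, rfl⟩ := this
    refine ⟨g, Subtype.ext (ContinuousLinearMap.ext fun b => ?_)⟩
    exact (hτ.smul_apply g b).trans (ha b).symm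

end IsFaithfulFiniteTrace

end Functionals

/-! ### Manifold structures on the orbit and the coset space. -/

section Orbit

instance MulAction.nonempty_orbit_coe {G S : Type*} [Group G] [MulAction G S] (s : S) :
    Nonempty (MulAction.orbit G s) :=
  (MulAction.nonempty_orbit s).to_subtype

variable {A : Type*} [CStarAlgebra A]

namespace IsFaithfulFiniteTrace

variable {τ : StrongDual ℂ A} (hτ : IsFaithfulFiniteTrace τ)

/-- The identification `α(g, τ) ↦ g g†` of the orbit with a set of self-adjoint elements. -/
noncomputable def orbitGram (x : MulAction.orbit Aˣ hτ.toSelfAdjointDual) : selfAdjoint A :=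
  gramUnits x.2.choose

@[simp]
theorem orbitGram_toOrbit (g : Aˣ) :
    hτ.orbitGram (toOrbit Aˣ hτ.toSelfAdjointDual g) = gramUnits g :=
  (hτ.smul_eq_smul_iff _ _).1 (toOrbit Aˣ hτ.toSelfAdjointDual g).2.choose_spec

theorem toOrbit_surjective : Function.Surjective (toOrbit Aˣ hτ.toSelfAdjointDual) := by
  rintro ⟨_, g, rfl⟩
  exact ⟨g, rfl⟩

theorem orbitGram_injective : Function.Injective hτ.orbitGram := by
  intro x y h
  obtain ⟨g, rfl⟩ := hτ.toOrbit_surjective x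
  obtain ⟨k, rfl⟩ := hτ.toOrbit_surjective y
  rw [orbitGram_toOrbit, orbitGram_toOrbit] at h
  exact Subtype.ext ((hτ.smul_eq_smul_iff g k).2 h)

theorem range_orbitGram : Set.range hτ.orbitGram = Set.range (gramUnits : Aˣ → selfAdjoint A) := by
  rw [← hτ.toOrbit_surjective.range_comp]
  exact congrArg Set.range (funext hτ.orbitGram_toOrbit)

theorem coe_orbitGram_smul (g : Aˣ) (x : MulAction.orbit Aˣ hτ.toSelfAdjointDual) :
    (hτ.orbitGram (g • x) : A) = (g : A) * (hτ.orbitGram x : A) * star (g : A) := by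
  obtain ⟨k, rfl⟩ := hτ.toOrbit_surjective x
  have : g • toOrbit Aˣ hτ.toSelfAdjointDual k = toOrbit Aˣ hτ.toSelfAdjointDual (g * k) :=
    Subtype.ext (mul_smul g k _).symm
  rw [this, orbitGram_toOrbit, orbitGram_toOrbit]
  simp [gramUnits, coe_gramMap, mul_assoc]

/-- The orbit is in bijection with the positive invertible elements. -/
theorem exists_orbit_equiv_positiveInvertibles :
    ∃ e : MulAction.orbit Aˣ hτ.toSelfAdjointDual ≃ positiveInvertibles A,
      ∀ g : Aˣ, (e (toOrbit Aˣ hτ.toSelfAdjointDual g) : A) = (g : A) * star (g : A) := by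
  have hmem (x : MulAction.orbit Aˣ hτ.toSelfAdjointDual) :
      (hτ.orbitGram x : A) ∈ positiveInvertibles A := by
    rw [positiveInvertibles_eq]
    exact ⟨_, rfl⟩
  refine ⟨Equiv.ofBijective (fun x => ⟨hτ.orbitGram x, hmem x⟩) ⟨fun x y h => ?_, ?_⟩, ?_⟩
  · have h' : (hτ.orbitGram x : A) = hτ.orbitGram y :=
      congrArg (fun p : positiveInvertibles A => (p : A)) h
    exact hτ.orbitGram_injective (Subtype.ext h')
  · rintro ⟨a, ha⟩
    rw [positiveInvertibles_eq] at ha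
    obtain ⟨g, rfl⟩ := ha
    have h : (hτ.orbitGram (toOrbit Aˣ _ g) : A) = g * star (g : A) :=
      congrArg Subtype.val (hτ.orbitGram_toOrbit g)
    exact ⟨toOrbit Aˣ _ g, Subtype.ext h⟩
  · exact fun g => congrArg Subtype.val (hτ.orbitGram_toOrbit g)

/-- The topology of the orbit as an open set of self-adjoint elements. -/
noncomputable abbrev orbitTopology :
    TopologicalSpace (MulAction.orbit Aˣ hτ.toSelfAdjointDual) :=
  .induced hτ.orbitGram inferInstance

/-- The topology is induced by an injection, so only openness of the range needs proof. -/
theorem isOpenEmbedding_orbitGram :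
    letI := hτ.orbitTopology
    Topology.IsOpenEmbedding hτ.orbitGram := by
  let := hτ.orbitTopology
  refine ⟨⟨⟨rfl⟩, hτ.orbitGram_injective⟩, ?_⟩
  rw [range_orbitGram]
  exact isOpenMap_gramUnits.isOpen_range

/-- The map `[g] ↦ g g†` on the coset space. -/
noncomputable def cosetGram (x : Aˣ ⧸ MulAction.stabilizer Aˣ hτ.toSelfAdjointDual) :
    selfAdjoint A :=
  hτ.orbitGram ((MulAction.orbitEquivQuotientStabilizer Aˣ hτ.toSelfAdjointDual).symm x)

theorem orbitEquivQuotientStabilizer_symm_mk (g : Aˣ) :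
    (MulAction.orbitEquivQuotientStabilizer Aˣ hτ.toSelfAdjointDual).symm
      (g : Aˣ ⧸ MulAction.stabilizer Aˣ hτ.toSelfAdjointDual) =
        toOrbit Aˣ hτ.toSelfAdjointDual g :=
  Subtype.ext (MulAction.orbitEquivQuotientStabilizer_symm_apply Aˣ hτ.toSelfAdjointDual g)

@[simp]
theorem cosetGram_mk (g : Aˣ) :
    hτ.cosetGram (g : Aˣ ⧸ MulAction.stabilizer Aˣ hτ.toSelfAdjointDual) = gramUnits g := by
  rw [cosetGram, orbitEquivQuotientStabilizer_symm_mk, orbitGram_toOrbit]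

/-- Here the topology is the quotient one, so openness is a real claim: the image of `U` is the
`gramUnits`-image of its preimage in `Aˣ`. -/
theorem isOpenEmbedding_cosetGram : Topology.IsOpenEmbedding hτ.cosetGram := by
  refine .of_continuous_injective_isOpenMap ?_
    (hτ.orbitGram_injective.comp (Equiv.injective _)) fun U hU => ?_
  · rw [(QuotientGroup.isQuotientMap_mk (N := MulAction.stabilizer Aˣ _)).continuous_iff]
    exact continuous_gramUnits.congr fun g => (hτ.cosetGram_mk g).symm
  · have : hτ.cosetGram '' U = gramUnits ''
        ((fun g : Aˣ => (g : Aˣ ⧸ MulAction.stabilizer Aˣ hτ.toSelfAdjointDual)) ⁻¹' U) := by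
      nth_rw 1 [← Set.image_preimage_eq U QuotientGroup.mk_surjective]
      rw [Set.image_image]
      simp only [cosetGram_mk]
    rw [this]
    exact isOpenMap_gramUnits _ (hU.preimage QuotientGroup.continuous_mk)

theorem coe_cosetGram_smul (g : Aˣ) (x : Aˣ ⧸ MulAction.stabilizer Aˣ hτ.toSelfAdjointDual) :
    (hτ.cosetGram (g • x) : A) = (g : A) * (hτ.cosetGram x : A) * star (g : A) := by
  obtain ⟨k, rfl⟩ := QuotientGroup.mk_surjective x
  rw [MulAction.Quotient.smul_mk, cosetGram_mk, cosetGram_mk]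
  simp [gramUnits, coe_gramMap, mul_assoc]

/-- The isotropy group of a faithful finite trace is a Banach-Lie subgroup. -/
theorem isBanachLieSubgroup_stabilizer :
    IsBanachLieSubgroup A (MulAction.stabilizer Aˣ hτ.toSelfAdjointDual) := by
  have : (MulAction.stabilizer Aˣ hτ.toSelfAdjointDual : Set Aˣ) =
      {g | gramUnits g = gramUnits 1} := by
    ext g
    have := hτ.smul_eq_smul_iff g 1
    rwa [one_smul] at this
  rw [IsBanachLieSubgroup, this]
  exact isBanachSubmanifold_gramUnits_eq _

theorem isSmoothCosetSpace :
    letI := hτ.isOpenEmbedding_cosetGram.singletonChartedSpace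
    IsSmoothCosetSpace A (selfAdjoint A) (MulAction.stabilizer Aˣ hτ.toSelfAdjointDual) :=
  let := hτ.isOpenEmbedding_cosetGram.singletonChartedSpace
  { isManifold := hτ.isOpenEmbedding_cosetGram.isManifold_singleton
    t2Space := hτ.isOpenEmbedding_cosetGram.t2Space
    isSubmersion := isSubmersion_of_gramUnits hτ.isOpenEmbedding_cosetGram hτ.cosetGram_mk
    smooth_action := contMDiffSMul_of_conj hτ.isOpenEmbedding_cosetGram hτ.coe_cosetGram_smul }

/-- The coset space is diffeomorphic to the orbit. -/
theorem exists_diffeomorph_orbit :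
    letI := hτ.isOpenEmbedding_cosetGram.singletonChartedSpace
    letI := hτ.orbitTopology
    letI := hτ.isOpenEmbedding_orbitGram.singletonChartedSpace
    ∃ Φ : Diffeomorph 𝓘(ℝ, selfAdjoint A) 𝓘(ℝ, selfAdjoint A)
        (Aˣ ⧸ MulAction.stabilizer Aˣ hτ.toSelfAdjointDual)
        (MulAction.orbit Aˣ hτ.toSelfAdjointDual) ∞,
      ∀ g : Aˣ, Φ (g : Aˣ ⧸ MulAction.stabilizer Aˣ hτ.toSelfAdjointDual) =
        toOrbit Aˣ hτ.toSelfAdjointDual g := by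
  let := hτ.isOpenEmbedding_cosetGram.singletonChartedSpace
  let := hτ.orbitTopology
  let := hτ.isOpenEmbedding_orbitGram.singletonChartedSpace
  refine ⟨⟨(MulAction.orbitEquivQuotientStabilizer Aˣ hτ.toSelfAdjointDual).symm, ?_, ?_⟩,
    hτ.orbitEquivQuotientStabilizer_symm_mk⟩
  -- Followed by `orbitGram`, the bijection is `cosetGram` by definition, hence smooth.
  · exact ContMDiff.of_comp_isOpenEmbedding hτ.isOpenEmbedding_orbitGram
      (contMDiff_isOpenEmbedding hτ.isOpenEmbedding_cosetGram)
  · refine ContMDiff.of_comp_isOpenEmbedding hτ.isOpenEmbedding_cosetGram ?_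
    have : hτ.cosetGram ∘ (MulAction.orbitEquivQuotientStabilizer Aˣ
        hτ.toSelfAdjointDual).symm.symm = hτ.orbitGram :=
      funext fun x => congrArg hτ.orbitGram (Equiv.symm_apply_apply _ x)
    rw [this]
    exact contMDiff_isOpenEmbedding hτ.isOpenEmbedding_orbitGram

theorem isHomogeneousOrbit :
    letI := hτ.orbitTopology
    letI := hτ.isOpenEmbedding_orbitGram.singletonChartedSpace
    IsHomogeneousOrbit A (selfAdjoint A) Aˣ hτ.toSelfAdjointDual :=
  let := hτ.orbitTopology
  let := hτ.isOpenEmbedding_orbitGram.singletonChartedSpace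
  { isManifold := hτ.isOpenEmbedding_orbitGram.isManifold_singleton
    t2Space := hτ.isOpenEmbedding_orbitGram.t2Space
    isBanachLieSubgroup := hτ.isBanachLieSubgroup_stabilizer
    exists_diffeomorph := ⟨hτ.isOpenEmbedding_cosetGram.singletonChartedSpace,
      hτ.isSmoothCosetSpace, hτ.exists_diffeomorph_orbit⟩
    isSubmersion := isSubmersion_of_gramUnits hτ.isOpenEmbedding_orbitGram hτ.orbitGram_toOrbit
    smooth_action := contMDiffSMul_of_conj hτ.isOpenEmbedding_orbitGram hτ.coe_orbitGram_smul }

end IsFaithfulFiniteTrace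

end Orbit

theorem mainTheorem4 {A : Type u} [CStarAlgebra A] (τ : StrongDual ℂ A)
    (hτ : IsFaithfulFiniteTrace τ) :
    -- the Lie algebra of the isotropy group is the space of skew-adjoint elements
    lieAlgebraOf (MulAction.stabilizer Aˣ hτ.toSelfAdjointDual) =
      (skewAdjoint.submodule ℝ A : Set A) ∧
    -- which is closed and complemented by the closed space of self-adjoint elements
    IsClosed (skewAdjoint.submodule ℝ A : Set A) ∧
    IsClosed (selfAdjoint.submodule ℝ A : Set A) ∧
    (skewAdjoint.submodule ℝ A).IsTopCompl (selfAdjoint.submodule ℝ A) ∧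
    -- the orbit is a smooth homogeneous Banach manifold, with tangent space the quotient of `A`
    -- by the Lie algebra of the isotropy group
    (∃ (E : Type u) (_ : NormedAddCommGroup E) (_ : NormedSpace ℝ E) (_ : CompleteSpace E)
      (_ : TopologicalSpace (MulAction.orbit Aˣ hτ.toSelfAdjointDual))
      (_ : ChartedSpace E (MulAction.orbit Aˣ hτ.toSelfAdjointDual)),
      IsHomogeneousOrbit A E Aˣ hτ.toSelfAdjointDual ∧
      ∀ a : A,
        mfderiv 𝓘(ℝ, A) 𝓘(ℝ, E) (toOrbit Aˣ hτ.toSelfAdjointDual) 1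
            (a : TangentSpace 𝓘(ℝ, A) (1 : Aˣ)) = 0 ↔
          a ∈ lieAlgebraOf (MulAction.stabilizer Aˣ hτ.toSelfAdjointDual)) ∧
    -- the positive invertible elements are those of the form `g g†`, and they are in bijection
    -- with the orbit
    positiveInvertibles A = {a : A | ∃ g : Aˣ, a = (g : A) * star (g : A)} ∧
    (∃ e : MulAction.orbit Aˣ hτ.toSelfAdjointDual ≃ positiveInvertibles A,
      ∀ g : Aˣ, (e (toOrbit Aˣ hτ.toSelfAdjointDual g) : A) = (g : A) * star (g : A)) ∧
    -- in finite dimension the orbit consists of all faithful positive functionals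
    (FiniteDimensional ℂ A →
      MulAction.orbit Aˣ hτ.toSelfAdjointDual =
        {ρ : SelfAdjointDual A | IsPositiveFunctional ρ.1 ∧ IsFaithfulFunctional ρ.1}) := by

  refine ⟨hτ.lieAlgebraOf_stabilizer, ?_, ?_, isTopCompl_skewAdjoint_selfAdjoint, ?_,
    positiveInvertibles_eq, hτ.exists_orbit_equiv_positiveInvertibles, fun _ => hτ.orbit_eq⟩
  · exact isClosed_eq continuous_star continuous_neg
  · exact isClosed_eq continuous_star continuous_id
  · let := hτ.orbitTopology
    refine ⟨selfAdjoint A, inferInstance, inferInstance, inferInstance, hτ.orbitTopology,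
      hτ.isOpenEmbedding_orbitGram.singletonChartedSpace, hτ.isHomogeneousOrbit, fun a => ?_⟩
    rw [hτ.lieAlgebraOf_stabilizer]
    exact mfderiv_eq_zero_iff_of_gramUnits hτ.isOpenEmbedding_orbitGram hτ.orbitGram_toOrbit a
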